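/- Let $\mathfrak g$ be a real Lie algebra of dimension $2n$. Suppose that $\mathfrak g$ is unimodular, i.e. $\operatorname{tr}(\mathrm{ad}_X)=0$ for every $X\in\mathfrak g$, and completely solvable, i.e. for every $X\in\mathfrak g$ all (complex) eigenvalues of $\mathrm{ad}_X$ are real. Let $J$ be a complex structure on $\mathfrak g$, i.e. a linear map $J:\mathfrak g\to\mathfrak g$ with $J^2=-\mathrm{id}$ and $[JX,JY]=[X,Y]+J[JX,Y]+J[X,JY]$ for all $X,Y\in\mathfrak g$, and let $\Omega$ be a symplectic form on $\mathfrak g$, i.e. a nondegenerate alternating bilinear form $\Omega:\mathfrak g\times\mathfrak g\to\mathbb R$ with $\Omega([X,Y],Z)+\Omega([Y,Z],X)+\Omega([Z,X],Y)=0$ for all $X,Y,Z\in\mathfrak g$. If $\Omega$ tames $J$, i.e. $\Omega(X,JX)>0$ for every nonzero $X\in\mathfrak g$, then $\mathfrak g$ is abelian. -/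

import Mathlib

/-- A real Lie algebra is unimodular if every adjoint map has trace zero. -/
def IsUnimodularLie (𝔤 : Type*) [LieRing 𝔤] [LieAlgebra ℝ 𝔤] : Prop :=
  ∀ X : 𝔤, LinearMap.trace ℝ 𝔤 (LieAlgebra.ad ℝ 𝔤 X) = 0

/-- A real Lie algebra is completely solvable if all the complex eigenvalues of every adjoint map
(that is, the eigenvalues of its complexification) are real. -/
def IsCompletelySolvableLie (𝔤 : Type*) [LieRing 𝔤] [LieAlgebra ℝ 𝔤] : Prop :=
  ∀ (X : 𝔤) (z : ℂ),
    Module.End.HasEigenvalue ((LieAlgebra.ad ℝ 𝔤 X : 𝔤 →ₗ[ℝ] 𝔤).baseChange ℂ) z → z.im = 0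

/-- The Chevalley-Eilenberg differential (with trivial coefficients) of a 2-form, evaluated on
three vectors. -/
def dTwoForm {𝔤 : Type*} [LieRing 𝔤] [LieAlgebra ℝ 𝔤] (Ω : LinearMap.BilinForm ℝ 𝔤)
    (X Y Z : 𝔤) : ℝ :=
  -Ω ⁅X, Y⁆ Z + Ω ⁅X, Z⁆ Y - Ω ⁅Y, Z⁆ X

/-- A symplectic form on a real Lie algebra: a closed, nondegenerate 2-form. -/
structure IsSymplecticForm {𝔤 : Type*} [LieRing 𝔤] [LieAlgebra ℝ 𝔤]
    (Ω : LinearMap.BilinForm ℝ 𝔤) : Prop where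
  isAlt : Ω.IsAlt
  nondegenerate : Ω.Nondegenerate
  closed : ∀ X Y Z : 𝔤, dTwoForm Ω X Y Z = 0

/-- An (integrable) complex structure on a real Lie algebra: a linear endomorphism with square
`-1` and vanishing Nijenhuis tensor. -/
structure IsComplexStructure {𝔤 : Type*} [LieRing 𝔤] [LieAlgebra ℝ 𝔤]
    (J : 𝔤 →ₗ[ℝ] 𝔤) : Prop where
  sq_eq_neg : ∀ X : 𝔤, J (J X) = -X
  integrable : ∀ X Y : 𝔤, ⁅J X, J Y⁆ - ⁅X, Y⁆ - J ⁅J X, Y⁆ - J ⁅X, J Y⁆ = 0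

/-- The 2-form `Ω` tames `J`. -/
def Tames {𝔤 : Type*} [LieRing 𝔤] [LieAlgebra ℝ 𝔤] (Ω : LinearMap.BilinForm ℝ 𝔤)
    (J : 𝔤 →ₗ[ℝ] 𝔤) : Prop :=
  ∀ X : 𝔤, X ≠ 0 → 0 < Ω X (J X)

open Module Polynomial in
theorem aeval_baseChange_complex {V : Type*} [AddCommGroup V] [Module ℝ V]
    (T : End ℝ V) (p : ℝ[X]) :
    aeval (LinearMap.baseChange ℂ T : End ℂ _) (p.map (algebraMap ℝ ℂ)) =
      (aeval T p).baseChange ℂ := by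
  have h := aeval_algHom_apply (End.baseChangeHom ℝ ℂ V) T p
  rw [aeval_map_algebraMap]
  exact h

open Module Polynomial in
theorem minpoly_splits_of_complex_eigenvalues_real {V : Type*} [AddCommGroup V] [Module ℝ V]
    [FiniteDimensional ℝ V] (T : End ℝ V)
    (h : ∀ z : ℂ, End.HasEigenvalue (T.baseChange ℂ : End ℂ _) z → z.im = 0) :
    (minpoly ℝ T).Splits := by
  have hc : T.charpoly.Splits := by
    refine Splits.of_splits_map (algebraMap ℝ ℂ) (IsAlgClosed.splits _) fun z hz => ?_
    rw [← LinearMap.charpoly_baseChange] at hz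
    have hz' := (End.hasEigenvalue_iff_isRoot_charpoly _ z).2 (isRoot_of_mem_roots hz)
    exact ⟨z.re, Complex.ext (by simp) (by simp [h z hz'])⟩
  exact hc.of_dvd (LinearMap.charpoly_monic T).ne_zero (LinearMap.minpoly_dvd_charpoly T)

open Module Polynomial in
theorem exists_real_of_hasEigenvalue_baseChange {V : Type*} [AddCommGroup V] [Module ℝ V]
    [FiniteDimensional ℝ V] {T : End ℝ V} (hT : (minpoly ℝ T).Splits) {z : ℂ}
    (hz : End.HasEigenvalue (T.baseChange ℂ : End ℂ _) z) : ∃ r : ℝ, (r : ℂ) = z := by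
  obtain ⟨v, hv⟩ := hz.exists_hasEigenvector
  have h0 : minpoly ℝ T ≠ 0 := minpoly.ne_zero (Algebra.IsIntegral.isIntegral T)
  have h := End.aeval_apply_of_hasEigenvector (p := (minpoly ℝ T).map (algebraMap ℝ ℂ)) hv
  rw [aeval_baseChange_complex, minpoly.aeval, LinearMap.baseChange_zero, LinearMap.zero_apply] at h
  have hr : ((minpoly ℝ T).map (algebraMap ℝ ℂ)).IsRoot z :=
    (smul_eq_zero.1 h.symm).resolve_right hv.2
  exact hT.mem_range_of_isRoot h0 hr

open Module Polynomial in
theorem hasEigenvalue_of_baseChange {V : Type*} [AddCommGroup V] [Module ℝ V]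
    [FiniteDimensional ℝ V] {T : End ℝ V} {r : ℝ}
    (hz : End.HasEigenvalue (T.baseChange ℂ : End ℂ _) (r : ℂ)) : T.HasEigenvalue r := by
  rw [End.hasEigenvalue_iff_isRoot_charpoly] at hz ⊢
  rw [LinearMap.charpoly_baseChange] at hz
  exact hz.of_map (f := algebraMap ℝ ℂ) (algebraMap ℝ ℂ).injective

open Module Polynomial ComplexOrder in
theorem trace_nonneg_of_complex_eigenvalues_nonneg {V : Type*} [AddCommGroup V] [Module ℝ V]
    [FiniteDimensional ℝ V] (T : End ℝ V)
    (h : ∀ z : ℂ, End.HasEigenvalue (T.baseChange ℂ : End ℂ _) z → 0 ≤ z) :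
    0 ≤ LinearMap.trace ℝ V T := by
  have ht := End.trace_eq_sum_roots_charpoly_of_splits
    (f := (T.baseChange ℂ : End ℂ _)) (IsAlgClosed.splits _)
  rw [LinearMap.trace_baseChange] at ht
  have : (0 : ℂ) ≤ algebraMap ℝ ℂ (LinearMap.trace ℝ V T) := by
    rw [ht]
    refine Multiset.sum_nonneg fun z hz => h z ?_
    exact (End.hasEigenvalue_iff_isRoot_charpoly _ z).2 (isRoot_of_mem_roots hz)
  exact Complex.zero_le_real.1 this

open Module in
theorem trace_nonneg_of_eigenvalues_nonneg {V : Type*} [AddCommGroup V] [Module ℝ V]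
    [FiniteDimensional ℝ V] {T : End ℝ V} (hT : (minpoly ℝ T).Splits)
    (h : ∀ r : ℝ, T.HasEigenvalue r → 0 ≤ r) : 0 ≤ LinearMap.trace ℝ V T := by
  refine trace_nonneg_of_complex_eigenvalues_nonneg T fun z hz => ?_
  obtain ⟨r, rfl⟩ := exists_real_of_hasEigenvalue_baseChange hT hz
  exact_mod_cast h r (hasEigenvalue_of_baseChange hz)

open Module ComplexOrder in
theorem trace_comp_self_nonneg {V : Type*} [AddCommGroup V] [Module ℝ V]
    [FiniteDimensional ℝ V] {T : End ℝ V} (hT : (minpoly ℝ T).Splits) :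
    0 ≤ LinearMap.trace ℝ V (T ∘ₗ T) := by
  refine trace_nonneg_of_complex_eigenvalues_nonneg _ fun z hz => ?_
  obtain ⟨w, rfl⟩ := IsAlgClosed.exists_pow_nat_eq z two_pos
  suffices h : ∃ r : ℝ, (r : ℂ) ^ 2 = w ^ 2 by
    obtain ⟨r, hr⟩ := h
    rw [← hr]
    exact_mod_cast sq_nonneg r
  obtain ⟨v, hv⟩ := hz.exists_hasEigenvector
  set S : End ℂ (TensorProduct ℝ ℂ V) := T.baseChange ℂ
  have hSS : S (S v) = w ^ 2 • v := by
    have := hv.apply_eq_smul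
    rwa [LinearMap.baseChange_comp] at this
  by_cases hu : S v = w • v
  · obtain ⟨r, hr⟩ := exists_real_of_hasEigenvalue_baseChange hT
      (End.hasEigenvalue_of_hasEigenvector ⟨End.mem_eigenspace_iff.2 hu, hv.2⟩)
    exact ⟨r, by rw [hr]⟩
  · have hu' : S (S v - w • v) = -w • (S v - w • v) := by
      rw [map_sub, map_smul, hSS]
      module
    obtain ⟨r, hr⟩ := exists_real_of_hasEigenvalue_baseChange hT
      (End.hasEigenvalue_of_hasEigenvector ⟨End.mem_eigenspace_iff.2 hu', sub_ne_zero.2 hu⟩)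
    exact ⟨r, by rw [hr, neg_sq]⟩

open Module Polynomial in
theorem ker_aeval_le_iSup_maxGenEigenspace {K V : Type*} [Field K] [AddCommGroup V] [Module K V]
    (T : End K V) (p : K[X]) (hp : p.Splits) (h0 : p ≠ 0) :
    LinearMap.ker (aeval T p) ≤ ⨆ μ, T.maxGenEigenspace μ := by
  induction hn : p.natDegree using Nat.strong_induction_on generalizing p with
  | _ n ih =>
    by_cases hd : p.degree = 0
    · intro v hv
      rw [eq_C_of_degree_eq_zero hd] at hv
      have hc : p.coeff 0 ≠ 0 := fun h => h0 (by rw [eq_C_of_degree_eq_zero hd, h, C_0])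
      have : v = 0 := by simpa [hc, Module.algebraMap_end_apply] using hv
      simp [this]
    · obtain ⟨a, ha⟩ := hp.exists_eval_eq_zero hd
      obtain ⟨q, hq, hqa⟩ := exists_eq_pow_rootMultiplicity_mul_and_not_dvd p h0 a
      set m := p.rootMultiplicity a
      have hm : 0 < m := (rootMultiplicity_pos h0).2 ha
      have hq0 : q ≠ 0 := by rintro rfl; simp at hqa
      have hcop : IsCoprime ((X - C a) ^ m) q :=
        ((irreducible_X_sub_C a).coprime_iff_not_dvd.2 hqa).pow_left
      have hqs : q.Splits := hp.of_dvd h0 ⟨_, hq.trans (mul_comm _ _)⟩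
      have hdeg : q.natDegree < n := by
        rw [← hn, hq, natDegree_mul (pow_ne_zero _ (X_sub_C_ne_zero a)) hq0]
        simp [hm]
      rw [hq, ← sup_ker_aeval_eq_ker_aeval_mul_of_coprime T hcop]
      refine sup_le (le_iSup_of_le a fun v hv => ?_) (ih _ hdeg q hqs hq0 rfl)
      rw [End.mem_maxGenEigenspace]
      refine ⟨m, ?_⟩
      simpa [Algebra.algebraMap_eq_smul_one] using hv

open Module Polynomial in
theorem iSup_maxGenEigenspace_eq_top_of_minpoly_splits {K V : Type*} [Field K] [AddCommGroup V]
    [Module K V] [FiniteDimensional K V] {T : End K V} (hT : (minpoly K T).Splits) :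
    ⨆ μ, T.maxGenEigenspace μ = ⊤ := by
  refine top_le_iff.1 (le_trans ?_ (ker_aeval_le_iSup_maxGenEigenspace T _ hT
    (minpoly.ne_zero (Algebra.IsIntegral.isIntegral T))))
  simp

open Module Polynomial in
theorem isNilpotent_of_minpoly_splits {K V : Type*} [Field K] [AddCommGroup V]
    [Module K V] [FiniteDimensional K V] {T : End K V} (hT : (minpoly K T).Splits)
    (h : ∀ r : K, T.HasEigenvalue r → r = 0) : IsNilpotent T := by
  have hi := Algebra.IsIntegral.isIntegral (R := K) T
  have hr : (minpoly K T).roots = Multiset.replicate (minpoly K T).roots.card 0 :=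
    Multiset.eq_replicate_card.2 fun r hr =>
      h r (End.hasEigenvalue_of_isRoot (isRoot_of_mem_roots hr))
  have he := hT.eq_prod_roots_of_monic (minpoly.monic hi)
  rw [hr] at he
  refine ⟨(minpoly K T).roots.card, ?_⟩
  simpa [minpoly.aeval] using (congrArg (aeval T) he).symm

theorem apply_eq_zero_of_apply_self_eq_zero {V : Type*} [AddCommGroup V] [Module ℝ V]
    {B : LinearMap.BilinForm ℝ V} (hs : LinearMap.IsSymm B) (hpos : ∀ x, 0 ≤ B x x) {x : V}
    (hx : B x x = 0) : B x = 0 := by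
  ext y
  have := LinearMap.BilinForm.apply_sq_le_of_symm B hpos hs x y
  rw [hx, zero_mul] at this
  simpa using le_antisymm this (sq_nonneg _)

/-- An endomorphism with real spectrum which is skew with respect to a positive semidefinite form
takes values in the radical of the form. -/
theorem skew_apply_mem_radical {V : Type*} [AddCommGroup V] [Module ℝ V]
    [FiniteDimensional ℝ V] {B : LinearMap.BilinForm ℝ V} (hs : LinearMap.IsSymm B)
    (hpos : ∀ x, 0 ≤ B x x) {T : Module.End ℝ V} (hT : (minpoly ℝ T).Splits)
    (hskew : ∀ x y, B (T x) y = -B x (T y)) (x : V) : B (T x) = 0 := by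
  have key : ∀ (μ : ℝ) (k : ℕ) (y : V), B (((T - μ • 1) ^ k) y) = 0 → B (T y) = 0 := by
    intro μ k y
    have hsc : ∀ a b, B a b = B b a := fun a b => by simpa using hs.eq a b
    have hTT : ∀ v, B (T v) v = 0 := fun v => by
      have := hskew v v
      rw [hsc v (T v)] at this
      linarith
    have htest : ∀ v, B ((T - μ • 1) v) = 0 → B (T v) = 0 ∧ μ ^ 2 * B v v = 0 := by
      intro v hv
      have h1 : B ((T - μ • 1) v) ((T - μ • 1) v) = 0 := by rw [hv]; rfl
      have h2 : B (T v) (T v) + μ ^ 2 * B v v = 0 := by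
        simp only [LinearMap.sub_apply, LinearMap.smul_apply, Module.End.one_apply, map_sub,
          map_smul, smul_eq_mul, hTT, hsc v (T v)] at h1
        linarith
      have h3 := hpos (T v)
      have h4 := mul_nonneg (sq_nonneg μ) (hpos v)
      exact ⟨apply_eq_zero_of_apply_self_eq_zero hs hpos (by linarith), by linarith⟩
    induction k with
    | zero =>
      intro h
      ext z
      rw [hskew, show B y = 0 by simpa using h]
      simp
    | succ k ih =>
      intro h
      rcases k with _ | k
      · exact (htest y (by simpa using h)).1
      · refine ih (apply_eq_zero_of_apply_self_eq_zero hs hpos ?_)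
        set u := ((T - μ • 1) ^ k) y
        have hv : ((T - μ • 1) ^ (k + 1)) y = (T - μ • 1) u := by rw [pow_succ']; rfl
        rw [pow_succ', Module.End.mul_apply] at h
        obtain ⟨h1, h2⟩ := htest _ h
        rw [hv] at h1 h2 ⊢
        set v := (T - μ • 1) u with hvd
        have h3 : B v v = -μ * B v u := by
          have : B v v = B v (T u) - μ * B v u := by
            rw [← smul_eq_mul, ← map_smul, ← map_sub]
            rfl
          have h4 := hskew v u
          rw [h1, LinearMap.zero_apply] at h4
          linarith
        by_cases hμ : μ = 0
        · simpa [hμ] using h3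
        · simpa [hμ] using h2
  have hmem : x ∈ ⨆ μ, T.maxGenEigenspace μ := by
    rw [iSup_maxGenEigenspace_eq_top_of_minpoly_splits hT]; trivial
  refine Submodule.iSup_induction _ (motive := fun x => B (T x) = 0) hmem ?_ (by simp)
    (fun a b ha hb => by rw [map_add, map_add, ha, hb, add_zero])
  intro μ y hy
  obtain ⟨k, hk⟩ := (Module.End.mem_maxGenEigenspace _ _ _).1 hy
  exact key μ k y (by rw [hk, map_zero])

open Polynomial in
theorem minpoly_splits_of_semiconj {V V' : Type*} [AddCommGroup V] [Module ℝ V]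
    [FiniteDimensional ℝ V] [AddCommGroup V'] [Module ℝ V'] {T : Module.End ℝ V}
    {T' : Module.End ℝ V'} (hT : (minpoly ℝ T).Splits) (K : Submodule ℝ V)
    (hK : ∀ v ∈ K, T v ∈ K) (p : V →ₗ[ℝ] V') (hp : ∀ v ∈ K, p (T v) = T' (p v))
    (hsurj : ∀ w, ∃ v ∈ K, p v = w) : (minpoly ℝ T').Splits := by
  have hpow : ∀ (k : ℕ), ∀ v ∈ K, (T ^ k) v ∈ K ∧ p ((T ^ k) v) = (T' ^ k) (p v) := by
    intro k v hv
    induction k with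
    | zero => simpa using hv
    | succ k ih =>
      rw [pow_succ', pow_succ', Module.End.mul_apply, Module.End.mul_apply, hp _ ih.1, ih.2]
      exact ⟨hK _ ih.1, rfl⟩
  have haeval : ∀ (q : ℝ[X]), ∀ v ∈ K, p (aeval T q v) = aeval T' q (p v) := by
    intro q v hv
    induction q using Polynomial.induction_on' with
    | add q r hq hr => simp [hq, hr]
    | monomial k a => simp [aeval_monomial, Module.algebraMap_end_apply, (hpow k v hv).2]
  refine hT.of_dvd (minpoly.ne_zero (Algebra.IsIntegral.isIntegral T)) (minpoly.dvd _ _ ?_)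
  ext w
  obtain ⟨v, hv, rfl⟩ := hsurj w
  rw [← haeval _ v hv]
  simp

/-- The Killing form is positive semidefinite if all adjoint maps have real spectrum, so that
Cartan's criterion applies. -/
theorem isSolvable_of_ad_minpoly_splits {L : Type*} [LieRing L] [LieAlgebra ℝ L]
    [FiniteDimensional ℝ L] (h : ∀ X : L, (minpoly ℝ (LieAlgebra.ad ℝ L X)).Splits) :
    LieAlgebra.IsSolvable L := by
  have hs : LinearMap.IsSymm (killingForm ℝ L) := ⟨fun x y => LieModule.traceForm_comm ℝ L L x y⟩
  have hpos : ∀ x, 0 ≤ killingForm ℝ L x x := fun x => by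
    rw [killingForm_apply_apply]
    exact trace_comp_self_nonneg (h x)
  have hlie : ∀ x y : L, killingForm ℝ L ⁅x, y⁆ = 0 := fun x y =>
    skew_apply_mem_radical hs hpos (h x)
      (fun a b => LieModule.traceForm_apply_lie_apply' ℝ L L x a b) y
  refine LieAlgebra.isSolvable_of_killingForm_apply_lie_eq_zero (R := ℝ) fun x y hy => ?_
  have hy' : y ∈ Submodule.span ℝ {⁅a, b⁆ | (a : L) (b : L)} := by
    rw [← LieAlgebra.coe_derivedSeries_one_eq]
    exact hy
  have hle : Submodule.span ℝ {⁅a, b⁆ | (a : L) (b : L)} ≤ LinearMap.ker (killingForm ℝ L) := by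
    rw [Submodule.span_le]
    rintro _ ⟨a, b, rfl⟩
    exact hlie a b
  rw [LieModule.traceForm_comm]
  exact DFunLike.congr_fun (hle hy') x

theorem exists_common_eigenvector_of_ad_minpoly_splits {L : Type*} [LieRing L] [LieAlgebra ℝ L]
    [FiniteDimensional ℝ L] [Nontrivial L]
    (h : ∀ X : L, (minpoly ℝ (LieAlgebra.ad ℝ L X)).Splits) :
    ∃ Z : L, Z ≠ 0 ∧ ∃ χ : Module.Dual ℝ L, ∀ X : L, ⁅X, Z⁆ = χ X • Z := by
  have := isSolvable_of_ad_minpoly_splits h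
  have : LieModule.IsTriangularizable ℝ L L :=
    ⟨fun x => iSup_maxGenEigenspace_eq_top_of_minpoly_splits (h x)⟩
  obtain ⟨χ, hχ⟩ := LieModule.exists_nontrivial_weightSpace_of_isSolvable ℝ L L
  obtain ⟨⟨Z, hZ⟩, hZ0⟩ := exists_ne (0 : LieModule.weightSpace L χ)
  refine ⟨Z, fun h0 => hZ0 (Subtype.ext h0), χ, ?_⟩
  exact (LieModule.mem_weightSpace _ _).1 hZ

/-- A closed 2-form taming a complex structure. -/
structure IsHermitianSymplectic {L : Type*} [LieRing L] [LieAlgebra ℝ L]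
    (Ω : LinearMap.BilinForm ℝ L) (J : L →ₗ[ℝ] L) : Prop where
  isAlt : Ω.IsAlt
  closed : ∀ X Y Z : L, dTwoForm Ω X Y Z = 0
  complex : IsComplexStructure J
  tames : Tames Ω J

/-- The functional `Ω Z`, normalized to take the value `1` at `J Z`. -/
noncomputable def normalizedContraction {L : Type*} [LieRing L] [LieAlgebra ℝ L]
    (Ω : LinearMap.BilinForm ℝ L) (J : L →ₗ[ℝ] L) (Z : L) : L →ₗ[ℝ] ℝ :=
  (Ω Z (J Z))⁻¹ • Ω Z

/-- The projection along the span of `Z` and `J Z` onto the largest `J`-invariant subspace on which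
`Ω Z` vanishes. -/
noncomputable def reductionProj {L : Type*} [LieRing L] [LieAlgebra ℝ L]
    (Ω : LinearMap.BilinForm ℝ L) (J : L →ₗ[ℝ] L) (Z : L) : L →ₗ[ℝ] L :=
  LinearMap.id - (normalizedContraction Ω J Z ∘ₗ J).smulRight Z -
    (normalizedContraction Ω J Z).smulRight (J Z)

theorem reductionProj_apply {L : Type*} [LieRing L] [LieAlgebra ℝ L]
    (Ω : LinearMap.BilinForm ℝ L) (J : L →ₗ[ℝ] L) (Z v : L) :
    reductionProj Ω J Z v = v - normalizedContraction Ω J Z (J v) • Z -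
      normalizedContraction Ω J Z v • J Z := rfl

namespace IsHermitianSymplectic

variable {L : Type*} [LieRing L] [LieAlgebra ℝ L] {Ω : LinearMap.BilinForm ℝ L} {J : L →ₗ[ℝ] L}
  {Z : L} {χ : L → ℝ}

local notation "τ" => normalizedContraction Ω J Z
local notation "P" => reductionProj Ω J Z

theorem pairing_pos (h : IsHermitianSymplectic Ω J) (hZ0 : Z ≠ 0) : 0 < Ω Z (J Z) :=
  h.tames Z hZ0

theorem pairing_eq (h : IsHermitianSymplectic Ω J) (hZ0 : Z ≠ 0) (v : L) :
    Ω Z v = Ω Z (J Z) * τ v := by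
  have := (h.pairing_pos hZ0).ne'
  simp [normalizedContraction, this]

theorem contraction_self (h : IsHermitianSymplectic Ω J) : τ Z = 0 := by
  simp [normalizedContraction, h.isAlt Z]

theorem contraction_J_self (h : IsHermitianSymplectic Ω J) (hZ0 : Z ≠ 0) : τ (J Z) = 1 := by
  have := (h.pairing_pos hZ0).ne'
  simp [normalizedContraction, this]

theorem contraction_J_J (h : IsHermitianSymplectic Ω J) (v : L) : τ (J (J v)) = -τ v := by
  rw [h.complex.sq_eq_neg, map_neg]

theorem contraction_lie (h : IsHermitianSymplectic Ω J) (hZ : ∀ X, ⁅X, Z⁆ = χ X • Z) (X Y : L) :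
    τ ⁅X, Y⁆ = χ Y * τ X - χ X * τ Y := by
  have h1 := h.closed X Y Z
  simp only [dTwoForm, hZ, map_smul, LinearMap.smul_apply, smul_eq_mul] at h1
  rw [← h.isAlt.neg_eq Z ⁅X, Y⁆] at h1
  simp only [normalizedContraction, LinearMap.smul_apply, smul_eq_mul]
  linear_combination (Ω Z (J Z))⁻¹ * h1

theorem contraction_proj (h : IsHermitianSymplectic Ω J) (hZ0 : Z ≠ 0) (v : L) :
    τ (P v) = 0 := by
  simp [reductionProj_apply, h.contraction_self, h.contraction_J_self hZ0]

theorem proj_J (h : IsHermitianSymplectic Ω J) (v : L) : P (J v) = J (P v) := by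
  simp only [reductionProj_apply, map_sub, map_smul, h.complex.sq_eq_neg, map_neg]
  module

theorem contraction_J_proj (h : IsHermitianSymplectic Ω J) (hZ0 : Z ≠ 0) (v : L) :
    τ (J (P v)) = 0 := by
  rw [← h.proj_J, h.contraction_proj hZ0]

theorem proj_self (h : IsHermitianSymplectic Ω J) (hZ0 : Z ≠ 0) : P Z = 0 := by
  simp [reductionProj_apply, h.contraction_self, h.contraction_J_self hZ0]

theorem proj_eq_self {v : L} (h1 : τ v = 0) (h2 : τ (J v) = 0) : P v = v := by
  simp [reductionProj_apply, h1, h2]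

theorem proj_proj (h : IsHermitianSymplectic Ω J) (hZ0 : Z ≠ 0) (v : L) : P (P v) = P v :=
  proj_eq_self (h.contraction_proj hZ0 v) (h.contraction_J_proj hZ0 v)

theorem proj_lie_proj (h : IsHermitianSymplectic Ω J) (hZ0 : Z ≠ 0)
    (hZ : ∀ X, ⁅X, Z⁆ = χ X • Z) (X : L) {v : L} (hv : τ v = 0) :
    P ⁅X, P v⁆ = P ⁅X, v⁆ := by
  rw [reductionProj_apply (v := v), hv]
  simp [hZ, h.proj_self hZ0]

theorem exists_reduction.{u} {L : Type u} [LieRing L] [LieAlgebra ℝ L]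
    {Ω : LinearMap.BilinForm ℝ L} {J : L →ₗ[ℝ] L} {Z : L} {χ : L → ℝ}
    (h : IsHermitianSymplectic Ω J) (hZ0 : Z ≠ 0) (hZ : ∀ X, ⁅X, Z⁆ = χ X • Z) :
    ∃ (L' : Type u) (_ : LieRing L') (_ : LieAlgebra ℝ L') (ι : L' →ₗ[ℝ] L) (p : L →ₗ[ℝ] L'),
      (∀ w, p (ι w) = w) ∧ (∀ v, ι (p v) = reductionProj Ω J Z v) ∧
      ∀ w w', ⁅w, w'⁆ = p ⁅ι w, ι w'⁆ := by
  let W := LinearMap.range (reductionProj Ω J Z)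
  let p : L →ₗ[ℝ] W := (reductionProj Ω J Z).rangeRestrict
  have hp : ∀ v, (p v : L) = reductionProj Ω J Z v := fun v => rfl
  have hpι : ∀ w : W, p w = w := by
    rintro ⟨_, v, rfl⟩
    exact Subtype.ext (h.proj_proj hZ0 v)
  have hτ : ∀ w : W, normalizedContraction Ω J Z (w : L) = 0 := by
    rintro ⟨_, v, rfl⟩
    exact h.contraction_proj hZ0 v
  have hlie : ∀ x y z : W, p ⁅(x : L), (p ⁅(y : L), (z : L)⁆ : L)⁆ =
      p ⁅(x : L), ⁅(y : L), (z : L)⁆⁆ := by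
    intro x y z
    refine Subtype.ext ?_
    rw [hp, hp, hp, h.proj_lie_proj hZ0 hZ]
    rw [h.contraction_lie hZ, hτ, hτ]
    simp
  let i1 : LieRing W :=
    { (inferInstance : AddCommGroup W) with
      bracket := fun x y => p ⁅(x : L), (y : L)⁆
      add_lie := fun x y z => by
        change p _ = p _ + p _
        simp
      lie_add := fun x y z => by
        change p _ = p _ + p _
        simp
      lie_self := fun x => by
        change p _ = 0
        simp
      leibniz_lie := fun x y z => by
        change p ⁅(x : L), (p ⁅(y : L), (z : L)⁆ : L)⁆ = p ⁅(p ⁅(x : L), (y : L)⁆ : L), (z : L)⁆ +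
          p ⁅(y : L), (p ⁅(x : L), (z : L)⁆ : L)⁆
        rw [← lie_skew (p ⁅(x : L), (y : L)⁆ : L) (z : L), map_neg, hlie, hlie, hlie,
          ← map_neg, lie_skew, ← map_add, ← leibniz_lie] }
  let i2 : LieAlgebra ℝ W :=
    { (inferInstance : Module ℝ W) with
      lie_smul := fun t x y => by
        change p ⁅(x : L), t • (y : L)⁆ = t • p _
        simp }
  exact ⟨W, i1, i2, W.subtype, p, hpι, hp, fun _ _ => rfl⟩

theorem comp {L' : Type*} [LieRing L'] [LieAlgebra ℝ L']
    {ι : L' →ₗ[ℝ] L} {p : L →ₗ[ℝ] L'}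
    (h : IsHermitianSymplectic Ω J) (hZ0 : Z ≠ 0) (hZ : ∀ X, ⁅X, Z⁆ = χ X • Z)
    (hpι : ∀ w, p (ι w) = w) (hιp : ∀ v, ι (p v) = P v)
    (hlie : ∀ w w', ⁅w, w'⁆ = p ⁅ι w, ι w'⁆) :
    IsHermitianSymplectic (Ω.comp ι ι) (p ∘ₗ J ∘ₗ ι) := by
  have hιJ : ∀ w, ι (p (J (ι w))) = J (ι w) := fun w => by rw [hιp, h.proj_J, ← hιp, hpι]
  have hτ : ∀ w, τ (ι w) = 0 := fun w => by rw [← hpι w, hιp, h.contraction_proj hZ0]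
  have hpJ : ∀ v, p (J (ι (p v))) = p (J v) := fun v => by
    rw [hιp, ← h.proj_J, ← hιp, hpι]
  have hι : ∀ w w', ι ⁅w, w'⁆ = ⁅ι w, ι w'⁆ - τ (J ⁅ι w, ι w'⁆) • Z := fun w w' => by
    rw [hlie, hιp, reductionProj_apply, h.contraction_lie hZ, hτ, hτ]
    simp
  have hΩZ : ∀ w, Ω Z (ι w) = 0 := fun w => by rw [h.pairing_eq hZ0, hτ, mul_zero]
  refine ⟨fun w => h.isAlt _, fun X Y V => ?_, ⟨fun w => ?_, fun X Y => ?_⟩, fun w hw => ?_⟩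
  · have := h.closed (ι X) (ι Y) (ι V)
    simp only [dTwoForm, LinearMap.BilinForm.comp_apply, hι, map_sub, map_smul,
      LinearMap.sub_apply, LinearMap.smul_apply, hΩZ, smul_zero, sub_zero] at this ⊢
    exact this
  · simp only [LinearMap.comp_apply]
    rw [hιJ, h.complex.sq_eq_neg, map_neg, hpι]
  · simp only [LinearMap.comp_apply, hlie, hιJ, hpJ, ← map_sub]
    rw [h.complex.integrable, map_zero]
  · have hιw : ι w ≠ 0 := fun h0 => hw (by rw [← hpι w, h0, map_zero])
    simpa [LinearMap.BilinForm.comp_apply, hιJ] using h.tames (ι w) hιw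

theorem minpoly_splits_comp [FiniteDimensional ℝ L] {L' : Type*} [AddCommGroup L'] [Module ℝ L']
    {ι : L' →ₗ[ℝ] L} {p : L →ₗ[ℝ] L'}
    (h : IsHermitianSymplectic Ω J) (hZ0 : Z ≠ 0) (hZ : ∀ X, ⁅X, Z⁆ = χ X • Z)
    (hpι : ∀ w, p (ι w) = w) (hιp : ∀ v, ι (p v) = P v)
    (hsplit : ∀ X : L, (minpoly ℝ (LieAlgebra.ad ℝ L X)).Splits)
    (X : L) (hX : ∀ v, τ v = 0 → τ ⁅X, v⁆ = 0) :
    (minpoly ℝ (p ∘ₗ LieAlgebra.ad ℝ L X ∘ₗ ι)).Splits := by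
  refine minpoly_splits_of_semiconj (hsplit X) (LinearMap.ker τ) (fun v hv => hX v hv) p
    (fun v hv => ?_) (fun w => ⟨ι w, ?_, hpι w⟩)
  · simp only [LinearMap.comp_apply, LieAlgebra.ad_apply]
    rw [hιp, ← hpι (p ⁅X, P v⁆), hιp, h.proj_lie_proj hZ0 hZ X hv, ← hιp, hpι]
  · rw [LinearMap.mem_ker, ← hpι w, hιp, h.contraction_proj hZ0]

theorem trace_comp [FiniteDimensional ℝ L] {L' : Type*} [AddCommGroup L'] [Module ℝ L']
    [FiniteDimensional ℝ L'] {ι : L' →ₗ[ℝ] L} {p : L →ₗ[ℝ] L'}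
    (hιp : ∀ v, ι (p v) = P v) (T : L →ₗ[ℝ] L) :
    LinearMap.trace ℝ L' (p ∘ₗ T ∘ₗ ι) = LinearMap.trace ℝ L T - τ (J (T Z)) - τ (T (J Z)) := by
  rw [LinearMap.trace_comp_comm', LinearMap.comp_assoc]
  have : T ∘ₗ ι ∘ₗ p = T - (τ ∘ₗ J).smulRight (T Z) - (τ).smulRight (T (J Z)) := by
    ext v
    simp [hιp, reductionProj_apply]
  rw [this]
  simp

variable {χ : Module.Dual ℝ L}

theorem character_lie (hZ0 : Z ≠ 0) (hZ : ∀ X, ⁅X, Z⁆ = χ X • Z) (X Y : L) : χ ⁅X, Y⁆ = 0 := by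
  have h1 := leibniz_lie X Y Z
  simp only [hZ, lie_smul, smul_smul] at h1
  rw [mul_comm, right_eq_add] at h1
  exact (smul_eq_zero.1 h1).resolve_right hZ0

theorem character_self (hZ0 : Z ≠ 0) (hZ : ∀ X, ⁅X, Z⁆ = χ X • Z) : χ Z = 0 := by
  have h1 := hZ Z
  rw [lie_self, eq_comm] at h1
  exact (smul_eq_zero.1 h1).resolve_right hZ0

theorem lie_J_J (h : IsHermitianSymplectic Ω J) (hZ : ∀ X, ⁅X, Z⁆ = χ X • Z) (X : L) :
    ⁅J Z, J X⁆ = J ⁅J Z, X⁆ - χ X • Z - χ (J X) • J Z := by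
  have h1 := h.complex.integrable Z X
  rw [← lie_skew Z X, ← lie_skew Z (J X), hZ, hZ, map_neg, map_smul] at h1
  linear_combination (norm := module) h1

theorem eq_smul_of_proj_eq_zero {v : L} (hP : P v = 0) (hv : τ v = 0) : v = τ (J v) • Z := by
  rw [reductionProj_apply, hv, zero_smul, sub_zero] at hP
  exact sub_eq_zero.1 hP

/-- If the reduction is abelian, then the character by which `L` acts on `Z` vanishes on the
complement of the span of `Z` and `J Z`. -/
theorem character_eq_zero (h : IsHermitianSymplectic Ω J) (hZ0 : Z ≠ 0)
    (hZ : ∀ X, ⁅X, Z⁆ = χ X • Z)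
    (hab : ∀ x y, τ x = 0 → τ (J x) = 0 → τ y = 0 → τ (J y) = 0 → P ⁅x, y⁆ = 0)
    {x : L} (hx : τ x = 0) (hJx : τ (J x) = 0) : χ x = 0 := by
  by_contra hχ
  have hJJx : τ (J (J x)) = 0 := by rw [h.contraction_J_J, hx, neg_zero]
  set T := J Z with hT
  have hτT : τ T = 1 := h.contraction_J_self hZ0
  have hτJT : τ (J T) = 0 := by rw [hT, h.contraction_J_J, h.contraction_self, neg_zero]
  have hPT : P T = 0 := by rw [hT, h.proj_J, h.proj_self hZ0, map_zero]
  have hτTlie : ∀ v, τ v = 0 → τ ⁅T, v⁆ = χ v := fun v hv => by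
    rw [h.contraction_lie hZ, hv, hτT]
    ring
  have hdecomp : ∀ v, τ v = 0 → ⁅T, v⁆ = P ⁅T, v⁆ + τ (J ⁅T, v⁆) • Z + χ v • T := fun v hv => by
    rw [reductionProj_apply, hτTlie v hv]
    module
  have hmix : ∀ y, τ y = 0 → τ (J y) = 0 → ∀ v, τ v = 0 → P ⁅y, ⁅T, v⁆⁆ = -χ v • P ⁅T, y⁆ := by
    intro y hy hJy v hv
    have h1 : P ⁅y, P ⁅T, v⁆⁆ = 0 :=
      hab _ _ hy hJy (h.contraction_proj hZ0 _) (h.contraction_J_proj hZ0 _)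
    rw [hdecomp v hv, lie_add, lie_add, map_add, map_add, h1, lie_smul, lie_smul, hZ, map_smul,
      map_smul, map_smul, h.proj_self hZ0, ← lie_skew y T, map_neg]
    module
  have hbr : ⁅x, J x⁆ = τ (J ⁅x, J x⁆) • Z :=
    eq_smul_of_proj_eq_zero (hab _ _ hx hJx hJx hJJx) (by
      rw [h.contraction_lie hZ, hx, hJx]
      ring)
  have hjac := leibniz_lie T x (J x)
  have hDJ : P ⁅T, J x⁆ = J (P ⁅T, x⁆) := by
    rw [lie_J_J h hZ, map_sub, map_sub, map_smul, map_smul, h.proj_self hZ0, ← hT, hPT, h.proj_J]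
    simp
  have hD : P ⁅T, x⁆ = 0 := by
    have h1 := congrArg P hjac
    rw [map_add, hmix x hx hJx _ hJx, ← lie_skew ⁅T, x⁆ (J x), map_neg, hmix _ hJx hJJx _ hx,
      hDJ, hbr, lie_smul, hZ, map_smul, map_smul, h.proj_self hZ0, smul_zero, smul_zero] at h1
    set d := P ⁅T, x⁆
    have h2 : χ (J x) • d = χ x • J d := by
      linear_combination (norm := module) h1
    have h3 : χ (J x) • J d = -(χ x • d) := by
      have := congrArg J h2
      rw [map_smul, map_smul, h.complex.sq_eq_neg] at this
      rw [this, smul_neg]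
    have h4 : (χ x ^ 2 + χ (J x) ^ 2) • d = 0 := by
      linear_combination (norm := module) χ (J x) • h2 + χ x • h3
    refine (smul_eq_zero.1 h4).resolve_left ?_
    positivity
  rw [hD, map_zero] at hDJ
  have ha : τ (J ⁅T, J x⁆) = -2 * χ x := by
    rw [lie_J_J h hZ, map_sub, map_sub, map_sub, map_sub, map_smul, map_smul, map_smul, map_smul,
      h.contraction_J_J, ← hT, hτTlie x hx, hτT, hτJT, smul_eq_mul, smul_eq_mul]
    ring
  have ha' : τ (J ⁅T, x⁆) = 2 * χ (J x) := by
    have h1 := hτTlie _ hJx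
    rw [lie_J_J h hZ, map_sub, map_sub, map_smul, map_smul, h.contraction_self, ← hT, hτT,
      smul_eq_mul, smul_eq_mul] at h1
    linarith
  have hTx := hdecomp x hx
  have hTJx := hdecomp (J x) hJx
  rw [hD, ha', zero_add] at hTx
  rw [hDJ, ha, zero_add] at hTJx
  have hχT : χ T = 0 := by
    have h1 := character_lie hZ0 hZ T x
    have h2 : χ Z = 0 := character_self hZ0 hZ
    rw [hTx, map_add, map_smul, map_smul, h2, smul_zero, zero_add, smul_eq_mul] at h1
    exact (mul_eq_zero.1 h1).resolve_left hχ
  rw [hbr, lie_smul, hZ, hχT, zero_smul, smul_zero, hTx, hTJx] at hjac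
  simp only [add_lie, lie_add, smul_lie, lie_smul] at hjac
  rw [← lie_skew x T, ← lie_skew Z (J x), hZ, hZ, hTx, hTJx] at hjac
  have h5 : (4 * (χ x ^ 2 + χ (J x) ^ 2)) • Z = 0 := by
    linear_combination (norm := module) hjac
  refine hZ0 ((smul_eq_zero.1 h5).resolve_left ?_)
  positivity

theorem isLieAbelian_of_reduction_abelian [FiniteDimensional ℝ L]
    (h : IsHermitianSymplectic Ω J) (hZ0 : Z ≠ 0)
    (hZ : ∀ X, ⁅X, Z⁆ = χ X • Z)
    (hunimod : IsUnimodularLie L)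
    (hsplit : ∀ X : L, (minpoly ℝ (LieAlgebra.ad ℝ L X)).Splits)
    {L' : Type*} [AddCommGroup L'] [Module ℝ L'] [FiniteDimensional ℝ L']
    {ι : L' →ₗ[ℝ] L} {p : L →ₗ[ℝ] L'}
    (hpι : ∀ w, p (ι w) = w) (hιp : ∀ v, ι (p v) = P v)
    (hab : ∀ w w', p ⁅ι w, ι w'⁆ = 0) : IsLieAbelian L := by
  have hτι : ∀ w, τ (ι w) = 0 := fun w => by rw [← hpι w, hιp, h.contraction_proj hZ0]
  have hJι : ∀ w, J (ι w) = ι (p (J (ι w))) := fun w => by rw [hιp, h.proj_J, ← hιp, hpι]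
  have hχι : ∀ w, χ (ι w) = 0 := fun w => by
    refine h.character_eq_zero hZ0 hZ (fun x y hx hJx hy hJy => ?_) (hτι w) (by rw [hJι, hτι])
    rw [← proj_eq_self hx hJx, ← proj_eq_self hy hJy, ← hιp, ← hιp, ← hιp, hab, map_zero]
  set T := J Z with hT
  set ℓ := χ T with hℓ
  have hτT : τ T = 1 := h.contraction_J_self hZ0
  have hχZ : χ Z = 0 := character_self hZ0 hZ
  have hdecomp : ∀ v, v = ι (p v) + τ (J v) • Z + τ v • T := fun v => by
    rw [hιp, reductionProj_apply]
    module
  have hχ : ∀ v, χ v = τ v * ℓ := fun v => by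
    conv_lhs => rw [hdecomp v]
    simp [hχι, hχZ, hℓ]
  let D : Module.End ℝ L' := p ∘ₗ LieAlgebra.ad ℝ L T ∘ₗ ι
  have hDι : ∀ w, ι (D w) = ⁅T, ι w⁆ := fun w => by
    have h1 : τ ⁅T, ι w⁆ = 0 := by rw [h.contraction_lie hZ, hχι, hτι]; ring
    have h2 : τ (J ⁅T, ι w⁆) = 0 := by
      have h3 : τ ⁅T, J (ι w)⁆ = 0 := by
        rw [h.contraction_lie hZ, hJι, hχι, hτι]; ring
      rw [lie_J_J h hZ, hJι, hχι, hχι] at h3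
      simpa using h3
    change ι (p ⁅T, ι w⁆) = _
    rw [hιp, proj_eq_self h1 h2]
  let j : L' →ₗ[ℝ] L' := p ∘ₗ J ∘ₗ ι
  have hj : ∀ w, ι (j w) = J (ι w) := fun w => (hJι w).symm
  have hιinj : Function.Injective ι := Function.LeftInverse.injective hpι
  have hDj : ∀ w, D (j w) = j (D w) := fun w => hιinj (by
    rw [hDι, hj, hj, hDι, lie_J_J h hZ, hχι, ← hj, hχι]
    simp [hT])
  let β : L' → L' → ℝ := fun w w' => τ (J ⁅ι w, ι w'⁆)
  have hβ : ∀ w w', ⁅ι w, ι w'⁆ = β w w' • Z := fun w w' =>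
    eq_smul_of_proj_eq_zero (by rw [← hιp, hab, map_zero])
      (by rw [h.contraction_lie hZ, hτι, hτι]; ring)
  have hc := h.pairing_pos hZ0
  set c := Ω Z T
  have hclosed : ∀ w w', Ω (ι (D w)) (ι w') + Ω (ι w) (ι (D w')) = -c * β w w' := fun w w' => by
    have h1 := h.closed (ι w) (ι w') T
    rw [dTwoForm, hβ, ← lie_skew _ T, ← lie_skew _ T, ← hDι, ← hDι] at h1
    simp only [map_neg, LinearMap.neg_apply, map_smul, LinearMap.smul_apply, smul_eq_mul] at h1
    rw [← h.isAlt.neg_eq (ι w) (ι (D w'))] at h1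
    linarith
  have hjac : ∀ w w', ℓ * β w w' = β (D w) w' + β w (D w') := fun w w' => by
    have h1 := leibniz_lie T (ι w) (ι w')
    rw [← hDι, ← hDι, hβ, hβ, hβ, lie_smul, hZ, smul_smul, ← add_smul] at h1
    rw [mul_comm]
    exact smul_left_injective ℝ hZ0 h1
  have hpos : ∀ w, w ≠ 0 → 0 < Ω (ι w) (ι (j w)) := fun w hw => by
    rw [hj]
    exact h.tames _ fun h0 => hw (hιinj (by rw [h0, map_zero]))
  have heig : ∀ μ, D.HasEigenvalue μ → 2 * μ * (2 * μ - ℓ) = 0 := fun μ hμ => by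
    obtain ⟨w, hw⟩ := hμ.exists_hasEigenvector
    have h1 : D w = μ • w := hw.apply_eq_smul
    have h2 : D (j w) = μ • j w := by rw [hDj, h1, map_smul]
    have h3 := hclosed w (j w)
    have h4 := hjac w (j w)
    have h5 : β (μ • w) (j w) = μ * β w (j w) := by simp [β]
    have h6 : β w (μ • j w) = μ * β w (j w) := by simp [β]
    rw [h1, h2, h5, h6] at h4
    simp only [h1, h2, map_smul, LinearMap.smul_apply, smul_eq_mul] at h3
    have h7 : 2 * μ * (2 * μ - ℓ) * Ω (ι w) (ι (j w)) = 0 := by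
      linear_combination (2 * μ - ℓ) * h3 + c * h4
    exact (mul_eq_zero.1 h7).resolve_right (hpos w hw.2).ne'
  have hDsplit : ∀ s : ℝ, (minpoly ℝ (s • D)).Splits := fun s => by
    have h1 := h.minpoly_splits_comp hZ0 hZ hpι hιp hsplit (s • T) fun v hv => by
      rw [smul_lie, map_smul, h.contraction_lie hZ, hχ v, hv]
      simp
    convert h1 using 2
    ext w
    simp [D]
  have hℓ0 : ℓ = 0 := by
    have htr : LinearMap.trace ℝ L' D = -ℓ := by
      rw [trace_comp hιp, hunimod]
      simp [hZ, ← hT, hτT, hℓ]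
    have h1 := trace_nonneg_of_eigenvalues_nonneg (hDsplit ℓ) fun r hr => by
      obtain ⟨w, hw⟩ := hr.exists_hasEigenvector
      by_contra! hlt
      have hne : ℓ ≠ 0 := by
        rintro h0
        have := hw.apply_eq_smul
        rw [h0, zero_smul, LinearMap.zero_apply, eq_comm, smul_eq_zero] at this
        exact this.elim hlt.ne hw.2
      have h2 : D w = (r / ℓ) • w := by
        have := hw.apply_eq_smul
        rw [LinearMap.smul_apply] at this
        rw [div_eq_inv_mul, ← smul_smul, ← this, smul_smul, inv_mul_cancel₀ hne, one_smul]
      have h3 := heig _ (Module.End.hasEigenvalue_of_hasEigenvector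
        ⟨Module.End.mem_eigenspace_iff.2 h2, hw.2⟩)
      have h4 : 2 * r * (2 * r - ℓ ^ 2) = 0 := by
        have h5 : r = ℓ * (r / ℓ) := by field_simp
        generalize r / ℓ = m at h3 h5
        rw [h5]
        linear_combination ℓ ^ 2 * h3
      nlinarith [sq_nonneg ℓ]
    rw [map_smul, htr, smul_eq_mul] at h1
    nlinarith
  have hker : ∀ w, D (D w) = 0 → D w = 0 := fun w hw => by
    by_contra hne
    have h1 := hclosed (D w) (j w)
    have h2 := hclosed w (j (D w))
    have h3 := hjac w (j w)
    have h4 := hpos _ hne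
    rw [hDj] at h1 h3
    rw [hDj] at h2
    rw [hw] at h1 h2
    simp only [hℓ0, map_zero, LinearMap.zero_apply] at h1 h2 h3
    nlinarith
  have hD : D = 0 := by
    have h1 : IsNilpotent D := isNilpotent_of_minpoly_splits (by simpa using hDsplit 1)
      fun r hr => by
        have := heig r hr
        rw [hℓ0] at this
        nlinarith
    obtain ⟨k, hk⟩ := h1
    have h2 : ∀ (k : ℕ) (w : L'), (D ^ (k + 1)) w = 0 → D w = 0 := by
      intro k
      induction k with
      | zero => intro w hw; simpa using hw
      | succ k ih =>
        intro w hw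
        exact hker w (ih (D w) (by rwa [pow_succ] at hw))
    ext w
    exact h2 k w (by rw [pow_succ', hk]; simp)
  have hβ0 : ∀ w w', β w w' = 0 := fun w w' => by
    have h1 := hclosed w w'
    simp only [hD, LinearMap.zero_apply, map_zero, add_zero] at h1
    exact (mul_eq_zero.1 h1.symm).resolve_left (neg_ne_zero.2 hc.ne')
  have hcent : ∀ v, ⁅v, Z⁆ = 0 := fun v => by rw [hZ, hχ, hℓ0, mul_zero, zero_smul]
  have hcent' : ∀ v : L, ⁅Z, v⁆ = 0 := fun v => by rw [← lie_skew, hcent, neg_zero]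
  have hTι : ∀ w, ⁅T, ι w⁆ = 0 := fun w => by rw [← hDι, hD]; simp
  have hTι' : ∀ w, ⁅ι w, T⁆ = 0 := fun w => by rw [← lie_skew, hTι, neg_zero]
  refine ⟨fun u v => ?_⟩
  rw [hdecomp u, hdecomp v]
  simp [hcent, hcent', hTι, hTι', hβ, hβ0]

end IsHermitianSymplectic

theorem isLieAbelian_of_isHermitianSymplectic.{u} (n : ℕ) (L : Type u) [LieRing L]
    [LieAlgebra ℝ L] [FiniteDimensional ℝ L] (hn : Module.finrank ℝ L = n)
    (Ω : LinearMap.BilinForm ℝ L) (J : L →ₗ[ℝ] L)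
    (h : IsHermitianSymplectic Ω J) (hunimod : IsUnimodularLie L)
    (hsplit : ∀ X : L, (minpoly ℝ (LieAlgebra.ad ℝ L X)).Splits) : IsLieAbelian L := by
  induction n using Nat.strong_induction_on generalizing L with
  | _ n ih =>
  rcases subsingleton_or_nontrivial L with hL | hL
  · exact ⟨fun _ _ => Subsingleton.elim _ _⟩
  obtain ⟨Z, hZ0, χ, hZ⟩ := exists_common_eigenvector_of_ad_minpoly_splits hsplit
  obtain ⟨L', i1, i2, ι, p, hpι, hιp, hlie⟩ := h.exists_reduction hZ0 hZ
  have hιinj : Function.Injective ι := Function.LeftInverse.injective hpι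
  have : FiniteDimensional ℝ L' := FiniteDimensional.of_injective ι hιinj
  have hτι : ∀ w, normalizedContraction Ω J Z (ι w) = 0 := fun w => by
    rw [← hpι w, hιp, h.contraction_proj hZ0]
  have hlt : Module.finrank ℝ L' < n := by
    rw [← LinearMap.finrank_range_of_inj hιinj, ← hn]
    refine Submodule.finrank_lt (ne_of_lt ?_)
    refine lt_top_iff_ne_top.2 fun htop => ?_
    obtain ⟨w, hw⟩ : J Z ∈ LinearMap.range ι := by rw [htop]; trivial
    have h1 := hτι w
    rw [hw, h.contraction_J_self hZ0] at h1
    exact one_ne_zero h1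
  have had : ∀ w, LieAlgebra.ad ℝ L' w = p ∘ₗ LieAlgebra.ad ℝ L (ι w) ∘ₗ ι := fun w => by
    ext w'
    simp [hlie]
  have hab := ih _ hlt L' rfl _ _ (h.comp hZ0 hZ hpι hιp hlie)
    (fun w => by
      rw [had, IsHermitianSymplectic.trace_comp hιp, hunimod]
      simp [hZ, h.contraction_lie hZ, hτι, h.contraction_J_self hZ0])
    (fun w => by
      rw [had]
      refine h.minpoly_splits_comp hZ0 hZ hpι hιp hsplit (ι w) fun v hv => ?_
      rw [h.contraction_lie hZ, hτι, hv]
      ring)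
  exact h.isLieAbelian_of_reduction_abelian hZ0 hZ hunimod hsplit hpι hιp
    fun w w' => by rw [← hlie, hab.trivial]

theorem theorem3p1 (n : ℕ) (𝔤 : Type*) [LieRing 𝔤] [LieAlgebra ℝ 𝔤] [FiniteDimensional ℝ 𝔤]
    (hdim : Module.finrank ℝ 𝔤 = 2 * n)
    (hunimod : IsUnimodularLie 𝔤) (hsolv : IsCompletelySolvableLie 𝔤)
    (Ω : LinearMap.BilinForm ℝ 𝔤) (J : 𝔤 →ₗ[ℝ] 𝔤)
    (hΩ : IsSymplecticForm Ω) (hJ : IsComplexStructure J) (htame : Tames Ω J) :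
    IsLieAbelian 𝔤 :=
  isLieAbelian_of_isHermitianSymplectic _ 𝔤 hdim Ω J ⟨hΩ.isAlt, hΩ.closed, hJ, htame⟩ hunimod
    fun X => minpoly_splits_of_complex_eigenvalues_real _ (hsolv X)
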